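/- Conventions. A \emph{compactly generated tensor triangulated category} is a triangulated category $\mathsf{T}$ with all set-indexed coproducts and a symmetric monoidal structure $(\otimes,\mathbf 1)$ such that: there is a set $G$ of compact objects for which $X\cong 0$ if and only if $\mathsf{T}(g,\Sigma^iX)=0$ for all $g\in G$, $i\in\mathbb Z$ (where $t$ is compact if $\mathsf{T}(t,-)$ preserves set-indexed coproducts); $\otimes$ is exact and coproduct preserving in each variable; and the full subcategory $\mathsf{T}^c$ of compact objects contains $\mathbf 1$ and is closed under $\otimes$. It is \emph{rigidly-compactly generated} if in addition $\mathsf{T}^c$ is rigid, i.e. it is closed symmetric monoidal and, with $k^\vee=\hom(k,\mathbf 1)$, the evaluation map $k^\vee\otimes l\to\hom(k,l)$ is an isomorphism for all $k,l\in\mathsf{T}^c$. A (full, replete) triangulated subcategory is \emph{localising} (resp. \emph{colocalising}) if it is closed under set-indexed coproducts (resp. products); a localising subcategory $\mathsf{I}$ is a \emph{localising tensor-ideal} if $X\otimes Y\in\mathsf{I}$ for all $X\in\mathsf{T}$, $Y\in\mathsf{I}$. For a set $S$ of objects, $\mathrm{loc}^\otimes(S)$ is the smallest localising tensor-ideal containing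 $S$. For a full subcategory $\mathsf{S}$, $\mathsf{S}^\perp=\{Y : \mathsf{T}(X,Y)=0 \text{ for all } X\in\mathsf{S}\}$, and ${}^\perp\mathsf{S}$ is defined dually. A \emph{localisation sequence} $$\mathsf{L}\ \underset{i^!}{\overset{i_*}{\rightleftarrows}}\ \mathsf{T}\ \underset{j_*}{\overset{j^*}{\rightleftarrows}}\ \mathsf{C}$$ consists of a localising subcategory $\mathsf{L}$ and a colocalising subcategory $\mathsf{C}$ of $\mathsf{T}$ with inclusions $i_*$ and $j_*$, a right adjoint $i^!$ of $i_*$ and a left adjoint $j^*$ of $j_*$, such that $\mathsf{L}^\perp=\mathsf{C}$ and ${}^\perp\mathsf{C}=\mathsf{L}$. It is \emph{smashing} if $i^!$ preserves coproducts. Theorem. Let $\mathsf{T}$ be a rigidly-compactly generated tensor triangulated category, $S\subseteq\mathsf{T}^c$ a set of compact objects, and set $\mathsf{S}=\mathrm{loc}^\otimes(S)$. Then there is a localisation sequence $$\mathsf{S}\ \underset{i^!}{\overset{i_*}{\rightleftarrows}}\ \mathsf{T}\ \underset{j_*}{\overset{j^*}{\rightleftarrows}}\ \mathsf{S}^\perp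 ,$$ every such sequence is smashing, and: (a) $\mathsf{S}^\perp$ is a localising tensor-ideal; (b) there are isomorphisms of functors $i_*i^!\mathbf 1\otimes(-)\cong i_*i^!$ and $j_*j^*\mathbf 1\otimes(-)\cong j_*j^*$; (c) $i_*i^!\mathbf 1\otimes i_*i^!\mathbf 1\cong i_*i^!\mathbf 1$, $\ j_*j^*\mathbf 1\otimes j_*j^*\mathbf 1\cong j_*j^*\mathbf 1$, and $i_*i^!\mathbf 1\otimes j_*j^*\mathbf 1\cong 0$. -/

import Mathlib

open CategoryTheory Limits MonoidalCategory

universe v u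

noncomputable section

namespace TensorTriangular

section Rigid

variable {K : Type u} [Category.{v} K] [MonoidalCategory K] [MonoidalClosed K]

/-- The dual `k^∨ = hom(k, 𝟙)` of an object of a closed monoidal category. -/
def dual (k : K) : K := (ihom k).obj (𝟙_ K)

/-- The evaluation map `k^∨ ⊗ l ⟶ hom(k, l)`: the adjunct of the composite
`k ⊗ (k^∨ ⊗ l) ≅ (k ⊗ k^∨) ⊗ l ⟶ 𝟙 ⊗ l ≅ l`. -/
def evaluationMap (k l : K) : dual k ⊗ l ⟶ (ihom k).obj l :=
  MonoidalClosed.curry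
    ((α_ k (dual k) l).inv ≫ ((ihom.ev k).app (𝟙_ K) ▷ l) ≫ (λ_ l).hom)

end Rigid

/-- A monoidal category is rigid if it is closed and all evaluation maps
`k^∨ ⊗ l ⟶ hom(k, l)` are isomorphisms. (The closed structure is unique up to isomorphism.) -/
def IsRigid (K : Type u) [Category.{v} K] [MonoidalCategory K] : Prop :=
  ∃ _ : MonoidalClosed K, ∀ k l : K, IsIso (evaluationMap k l)

/-- A functor preserves all set-indexed coproducts. -/
def PreservesCoproducts {C : Type*} [Category.{v} C] {D : Type*} [Category* D]
    (F : C ⥤ D) : Prop :=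
  ∀ J : Type v, PreservesColimitsOfShape (Discrete J) F

section Triangulated

variable {T : Type u} [Category.{v} T] [HasZeroObject T] [HasShift T ℤ] [Preadditive T]
  [∀ n : ℤ, (shiftFunctor T n).Additive] [Pretriangulated T]

/-- An endofunctor is exact if, for some natural commutation with the shifts, it sends
distinguished triangles to distinguished triangles. -/
def IsExact (F : T ⥤ T) : Prop :=
  ∃ _ : F.CommShift ℤ, F.IsTriangulated

/-- An object `t` is compact if `T(t, -)`, as a functor to abelian groups, preserves set-indexed
coproducts. -/
def isCompact (T : Type u) [Category.{v} T] [Preadditive T] : ObjectProperty T :=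
  fun t => PreservesCoproducts (preadditiveCoyoneda.obj (Opposite.op t))

/-- Localising subcategories: (full, replete) triangulated subcategories closed under set-indexed
coproducts. -/
structure IsLocalising (L : ObjectProperty T) : Prop where
  isTriangulated : L.IsTriangulated
  isClosedUnderIsomorphisms : L.IsClosedUnderIsomorphisms
  coproducts : ∀ J : Type v, L.IsClosedUnderColimitsOfShape (Discrete J)

/-- Colocalising subcategories: (full, replete) triangulated subcategories closed under
set-indexed products. -/
structure IsColocalising (L : ObjectProperty T) : Prop where
  isTriangulated : L.IsTriangulated
  isClosedUnderIsomorphisms : L.IsClosedUnderIsomorphisms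
  products : ∀ J : Type v, L.IsClosedUnderLimitsOfShape (Discrete J)

/-- Localising tensor-ideals. -/
structure IsLocalisingTensorIdeal [MonoidalCategory T] (I : ObjectProperty T) : Prop where
  isLocalising : IsLocalising I
  tensor_mem : ∀ X Y : T, I Y → I (X ⊗ Y)

/-- `loc^⊗(S)`, the smallest localising tensor-ideal containing `S`, as the intersection of all
of them. -/
def locTensor [MonoidalCategory T] (S : ObjectProperty T) : ObjectProperty T :=
  fun X => ∀ I : ObjectProperty T, IsLocalisingTensorIdeal I → S ≤ I → I X

lemma le_locTensor [MonoidalCategory T] (S : ObjectProperty T) : S ≤ locTensor S :=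
  fun X hX _ _ hS => hS X hX

/-- `loc^⊗(S)` is indeed a localising tensor-ideal. -/
lemma isLocalisingTensorIdeal_locTensor [MonoidalCategory T] (S : ObjectProperty T) :
    IsLocalisingTensorIdeal (locTensor S) := by
  have iso : (locTensor S).IsClosedUnderIsomorphisms := ⟨fun e hX I hI hS => by
    have := hI.isLocalising.isClosedUnderIsomorphisms
    exact I.prop_of_iso e (hX I hI hS)⟩
  refine ⟨⟨?_, iso, fun J => ⟨?_⟩⟩, fun X Y hY I hI hS => hI.tensor_mem X Y (hY I hI hS)⟩
  · refine { exists_zero := ⟨_, HasZeroObject.zero.choose_spec, fun I hI _ => ?_⟩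
             isStableUnderShiftBy := fun n => ⟨fun X hX I hI hS => ?_⟩
             toIsTriangulatedClosed₂ := .mk' fun D hD h₁ h₃ I hI hS => ?_ }
    · have := hI.isLocalising.isClosedUnderIsomorphisms
      have := hI.isLocalising.isTriangulated
      exact I.prop_zero
    · have := hI.isLocalising.isTriangulated
      exact I.le_shift n X (hX I hI hS)
    · have := hI.isLocalising.isClosedUnderIsomorphisms
      have := hI.isLocalising.isTriangulated
      exact I.ext_of_isTriangulatedClosed₂ D hD (h₁ I hI hS) (h₃ I hI hS)
  · rintro X ⟨h⟩ I hI hS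
    have := hI.isLocalising.coproducts J
    exact ObjectProperty.IsClosedUnderColimitsOfShape.colimitsOfShape_le (P := I) (J := Discrete J)
      X ⟨{ toColimitPresentation := h.toColimitPresentation
           prop_diag_obj := fun j => h.prop_diag_obj j I hI hS }⟩

/-- A localisation sequence `L ⇄ T ⇄ C`, in which `L` and `C` are identified with subcategories of
`T`: the functors `i_*` and `j_*` are the inclusions `L.ι` and `C.ι`. -/
structure LocalisationSequence (L C : ObjectProperty T) where
  /-- `i^!` -/
  iShriek : T ⥤ L.FullSubcategory
  /-- `i^!` is right adjoint to `i_*`. -/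
  iAdj : L.ι ⊣ iShriek
  /-- `j^*` -/
  jStar : T ⥤ C.FullSubcategory
  /-- `j_*` is right adjoint to `j^*`. -/
  jAdj : jStar ⊣ C.ι
  isLocalising : IsLocalising L
  isColocalising : IsColocalising C
  rightOrthogonal_eq : L.rightOrthogonal = C
  leftOrthogonal_eq : C.leftOrthogonal = L

namespace LocalisationSequence

variable {L C : ObjectProperty T} (E : LocalisationSequence L C)

/-- The acyclisation functor `i_* i^!`. -/
abbrev acyclisation : T ⥤ T := E.iShriek ⋙ L.ι

/-- The localisation functor `j_* j^*`. -/
abbrev localisation : T ⥤ T := E.jStar ⋙ C.ι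

/-- The localisation sequence is smashing if `i^!` preserves coproducts. -/
def IsSmashing : Prop := PreservesCoproducts E.iShriek

end LocalisationSequence

/-- Compactly generated triangulated categories (in the presence of set-indexed coproducts). -/
class IsCompactlyGenerated (T : Type u) [Category.{v} T] [HasZeroObject T] [HasShift T ℤ]
    [Preadditive T] [∀ n : ℤ, (shiftFunctor T n).Additive] [Pretriangulated T]
    [HasCoproducts.{v} T] : Prop where
  exists_generators : ∃ G : ObjectProperty T, ObjectProperty.Small.{v} G ∧ G ≤ isCompact T ∧
    ∀ X : T, IsZero X ↔ ∀ g : T, G g → ∀ (i : ℤ) (f : g ⟶ X⟦i⟧), f = 0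

/-- Compactly generated tensor triangulated categories: the tensor product is exact and preserves
coproducts in each variable, and the compact objects contain the unit and are closed under the
tensor product. -/
class IsCompactlyGeneratedTensor (T : Type u) [Category.{v} T] [HasZeroObject T] [HasShift T ℤ]
    [Preadditive T] [∀ n : ℤ, (shiftFunctor T n).Additive] [Pretriangulated T]
    [HasCoproducts.{v} T] [MonoidalCategory T] [SymmetricCategory T] : Prop
    extends IsCompactlyGenerated T where
  exact_left : ∀ X : T, IsExact (tensorLeft X)
  exact_right : ∀ X : T, IsExact (tensorRight X)
  coproducts_left : ∀ X : T, PreservesCoproducts (tensorLeft X)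
  coproducts_right : ∀ X : T, PreservesCoproducts (tensorRight X)
  isMonoidal_compact : (isCompact T).IsMonoidal

attribute [instance] IsCompactlyGeneratedTensor.isMonoidal_compact

/-- Rigidly-compactly generated tensor triangulated categories: the full tensor subcategory of
compact objects is rigid. -/
class IsRigidlyCompactlyGenerated (T : Type u) [Category.{v} T] [HasZeroObject T] [HasShift T ℤ]
    [Preadditive T] [∀ n : ℤ, (shiftFunctor T n).Additive] [Pretriangulated T]
    [HasCoproducts.{v} T] [MonoidalCategory T] [SymmetricCategory T] : Prop
    extends IsCompactlyGeneratedTensor T where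
  rigid : IsRigid (isCompact T).FullSubcategory

end Triangulated

end TensorTriangular

end

open TensorTriangular

/-!
Everything is governed by one distinguished triangle `L ⟶ 𝟙 ⟶ C ⟶ L⟦1⟧` with `L` in
`P = loc^⊗(S)` and `C` in its orthogonal `P^⊥`. Since `P` and, by rigidity, `P^⊥` are tensor-ideals,
tensoring with `X` gives a triangle `L ⊗ X ⟶ X ⟶ C ⊗ X` of the same kind, naturally in `X`. Hence
`L ⊗ -` is right adjoint to the inclusion of `P` and `C ⊗ -` is left adjoint to the inclusion of
`P^⊥`. This provides the localisation sequence (`localisationSequenceOfUnitTriangle`), and by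
uniqueness of adjoints it identifies `i_* i^!` with `L ⊗ -` and `j_* j^*` with `C ⊗ -` for every
other one; in particular `L ≅ i_* i^! 𝟙` and `C ≅ j_* j^* 𝟙`, and `i_* i^!` preserves coproducts.

The triangle comes from a cellular approximation (`exists_cellular_approximation`): given a set of
compact objects `a i`, one attaches cells to build a sequence of objects over `X` whose homotopy
colimit `L ⟶ X` induces bijections on maps from all `a i`; if the set is closed under shifts, the
cone of `L ⟶ X` then receives no nonzero map from any `a i`. Compactness enters because every map
from `a i` to the homotopy colimit factors through a stage of the sequence. Applied to a set of
compact generators, this shows that they lie in no proper localising subcategory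
(`IsLocalising.eq_top`). It follows that an object is orthogonal to `loc^⊗(S)` once it receives no
nonzero map from the shifts of the `g ⊗ s`, for `g` a generator and `s` in `S`
(`rightOrthogonal_locTensor`). These objects are compact, so the approximation applies to them and
gives the triangle, and their orthogonal `P^⊥` is closed under coproducts.

To see that `P^⊥` is a tensor-ideal, it is then enough to tensor `Y` in `P^⊥` with a compact object
`k`. Rigidity provides a pairing `k ⊗ D ⟶ 𝟙` and a copairing `𝟙 ⟶ D ⊗ k` satisfying one triangle
identity, by which a map `Z ⟶ Y ⊗ k` is recovered from its adjunct `Z ⊗ D ⟶ Y` (`eq_of_pairing`);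
the latter vanishes if `Z`, hence `Z ⊗ D`, lies in `P`.
-/

open TensorTriangular

namespace TensorTriangular

open Pretriangulated

/-! ### Compact objects and coproducts -/

section Compact

variable {T : Type u} [Category.{v} T] [Preadditive T]

/-- A map from a compact object to a coproduct is a finite sum of maps factoring through the
summands. -/
lemma isCompact.mem_closure {t : T} (ht : isCompact T t) {J : Type v} {Y : J → T} {c : Cofan Y}
    (hc : IsColimit c) (f : t ⟶ c.pt) :
    f ∈ AddSubgroup.closure {h : t ⟶ c.pt | ∃ (j : J) (g : t ⟶ Y j), g ≫ c.inj j = h} := by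
  set H := AddSubgroup.closure {h : t ⟶ c.pt | ∃ (j : J) (g : t ⟶ Y j), g ≫ c.inj j = h}
  have := ht J
  have hc' := isColimitOfPreserves (preadditiveCoyoneda.obj (Opposite.op t)) hc
  -- The quotient map by `H` and the zero map agree on all summands, hence they agree.
  have key : AddCommGrpCat.ofHom (QuotientAddGroup.mk' H) =
      (0 : AddCommGrpCat.of (t ⟶ c.pt) ⟶ AddCommGrpCat.of ((t ⟶ c.pt) ⧸ H)) := by
    refine hc'.hom_ext fun ⟨j⟩ => ?_
    ext g
    exact (QuotientAddGroup.eq_zero_iff _).2 (AddSubgroup.subset_closure ⟨j, g, rfl⟩)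
  exact (QuotientAddGroup.eq_zero_iff f).1 (congr($key f))

/-- Maps from a compact object to a coproduct are detected by the projections to the summands. -/
lemma isCompact.eq_zero_of_comp_eq_zero {t : T} (ht : isCompact T t) {J : Type v} {Y : J → T}
    {c : Cofan Y} (hc : IsColimit c) (π : ∀ j, c.pt ⟶ Y j) (hπ : ∀ j, c.inj j ≫ π j = 𝟙 _)
    (hπ' : ∀ j k, j ≠ k → c.inj j ≫ π k = 0) (f : t ⟶ c.pt) (hf : ∀ j, f ≫ π j = 0) : f = 0 := by
  classical
  -- `f` is recovered from its components along any large enough finite set of summands.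
  obtain ⟨s, hs⟩ : ∃ s : Finset J, ∀ r : Finset J, s ⊆ r →
      f = ∑ j ∈ r, f ≫ π j ≫ c.inj j := by
    clear hf
    induction ht.mem_closure hc f using AddSubgroup.closure_induction with
    | mem f h =>
      obtain ⟨j, g, rfl⟩ := h
      refine ⟨{j}, fun r hr => ?_⟩
      rw [Finset.sum_eq_single_of_mem j (hr (Finset.mem_singleton_self j)) fun k _ hk => by
        simp [reassoc_of% (hπ' j k hk.symm)]]
      simp [reassoc_of% (hπ j)]
    | zero => exact ⟨∅, by simp⟩
    | add f g _ _ hf hg =>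
      obtain ⟨s, hs⟩ := hf
      obtain ⟨s', hs'⟩ := hg
      refine ⟨s ∪ s', fun r hr => ?_⟩
      simp only [Preadditive.add_comp, Finset.sum_add_distrib]
      rw [← hs r (Finset.union_subset_left hr), ← hs' r (Finset.union_subset_right hr)]
    | neg f _ hf =>
      obtain ⟨s, hs⟩ := hf
      refine ⟨s, fun r hr => ?_⟩
      simp only [Preadditive.neg_comp, Finset.sum_neg_distrib]
      rw [← hs r hr]
  rw [hs s le_rfl]
  exact Finset.sum_eq_zero fun j _ => by rw [reassoc_of% (hf j), zero_comp]

/-- The projection of a coproduct to a summand, in a preadditive category. -/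
noncomputable def sigmaProj {J : Type v} (Y : J → T) {c : Cofan Y} (hc : IsColimit c) (j : J) :
    c.pt ⟶ Y j := by
  classical
  exact Cofan.IsColimit.desc hc fun k => if h : k = j then eqToHom (by rw [h]) else 0

lemma inj_sigmaProj {J : Type v} (Y : J → T) {c : Cofan Y} (hc : IsColimit c) (j : J) :
    c.inj j ≫ sigmaProj Y hc j = 𝟙 _ := by
  simp [sigmaProj, Cofan.IsColimit.fac]

lemma inj_sigmaProj_of_ne {J : Type v} (Y : J → T) {c : Cofan Y} (hc : IsColimit c) (j k : J)
    (h : j ≠ k) : c.inj j ≫ sigmaProj Y hc k = 0 := by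
  simp [sigmaProj, Cofan.IsColimit.fac, h]

/-- Objects receiving no nonzero map from a given compact object are closed under coproducts. -/
lemma isCompact.eq_zero_of_isColimit {t : T} (ht : isCompact T t) {J : Type v} {Y : J → T}
    {c : Cofan Y} (hc : IsColimit c) (hY : ∀ j (g : t ⟶ Y j), g = 0) (f : t ⟶ c.pt) : f = 0 :=
  ht.eq_zero_of_comp_eq_zero hc (sigmaProj Y hc) (inj_sigmaProj Y hc) (inj_sigmaProj_of_ne Y hc) f
    fun j => hY j _

lemma isCompact.shift [HasShift T ℤ] [∀ n : ℤ, (shiftFunctor T n).Additive] {t : T}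
    (ht : isCompact T t) (n : ℤ) : isCompact T (t⟦n⟧) := fun J => by
  have := ht J
  let adj : shiftFunctor T n ⊣ shiftFunctor T (-n) := (shiftEquiv T n).toAdjunction
  let e : shiftFunctor T (-n) ⋙ preadditiveCoyoneda.obj (Opposite.op t) ≅
      preadditiveCoyoneda.obj (Opposite.op (t⟦n⟧)) :=
    NatIso.ofComponents (fun Y => (adj.homAddEquiv t Y).symm.toAddCommGrpIso) fun f => by
      ext g
      exact adj.homEquiv_naturality_right_symm g f
  exact preservesColimitsOfShape_of_natIso e

end Compact

/-! ### Homotopy colimits and cellular approximation -/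

section Cellular

variable {T : Type u} [Category.{v} T] [HasZeroObject T] [HasShift T ℤ] [Preadditive T]
  [∀ n : ℤ, (shiftFunctor T n).Additive] [Pretriangulated T]

lemma IsLocalising.sigma_mem [HasCoproducts.{v} T] {P : ObjectProperty T} (hP : IsLocalising P)
    {J : Type v} (Y : J → T) (hY : ∀ j, P (Y j)) : P (∐ Y) :=
  have := hP.coproducts J
  P.prop_colimit _ fun j => hY j.as

lemma IsLocalising.mem_of_iso {P : ObjectProperty T} (hP : IsLocalising P) {X Y : T} (e : X ≅ Y)
    (hX : P X) : P Y :=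
  have := hP.isClosedUnderIsomorphisms
  P.prop_of_iso e hX

lemma IsLocalising.ext₃ {P : ObjectProperty T} (hP : IsLocalising P) {A : Triangle T}
    (hA : A ∈ distTriang T) (h₁ : P A.obj₁) (h₂ : P A.obj₂) : P A.obj₃ :=
  have := hP.isClosedUnderIsomorphisms
  have := hP.isTriangulated
  P.ext_of_isTriangulatedClosed₃ A hA h₁ h₂

lemma IsLocalising.ext₂ {P : ObjectProperty T} (hP : IsLocalising P) {A : Triangle T}
    (hA : A ∈ distTriang T) (h₁ : P A.obj₁) (h₃ : P A.obj₃) : P A.obj₂ :=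
  have := hP.isClosedUnderIsomorphisms
  have := hP.isTriangulated
  P.ext_of_isTriangulatedClosed₂ A hA h₁ h₃

/-- The homotopy colimit of a sequence, the cone of `1 - shift` on the coproduct of its terms: it
is a weak colimit, it belongs to every localising subcategory containing the terms, and every map
from a compact object to it factors through some term. -/
lemma exists_homotopyColimit [HasCoproducts.{v} T] (F : ℕ → T) (s : ∀ n, F n ⟶ F (n + 1)) :
    ∃ (L : T) (ι : ∀ n, F n ⟶ L), (∀ n, s n ≫ ι (n + 1) = ι n) ∧
      (∀ P : ObjectProperty T, IsLocalising P → (∀ n, P (F n)) → P L) ∧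
      (∀ (X : T) (u : ∀ n, F n ⟶ X), (∀ n, s n ≫ u (n + 1) = u n) →
        ∃ w : L ⟶ X, ∀ n, ι n ≫ w = u n) ∧
      ∀ (t : T), isCompact T t → ∀ f : t ⟶ L, ∃ (n : ℕ) (g : t ⟶ F n), g ≫ ι n = f := by
  let Y : ULift.{v} ℕ → T := fun n => F n.down
  let inj (n : ℕ) : F n ⟶ ∐ Y := Sigma.ι Y ⟨n⟩
  let σ : ∐ Y ⟶ ∐ Y := Sigma.desc fun n : ULift.{v} ℕ => s n.down ≫ inj (n.down + 1)
  have inj_σ (n : ℕ) : inj n ≫ σ = s n ≫ inj (n + 1) := Sigma.ι_desc _ _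
  have hom_ext {X : T} {f g : ∐ Y ⟶ X} (h : ∀ n, inj n ≫ f = inj n ≫ g) : f = g :=
    Sigma.hom_ext _ _ fun n => h n.down
  obtain ⟨L, q, δ, hL⟩ := distinguished_cocone_triangle (𝟙 (∐ Y) - σ)
  have hq : (𝟙 (∐ Y) - σ) ≫ q = 0 := comp_distTriang_mor_zero₁₂ _ hL
  have hι (n : ℕ) : s n ≫ inj (n + 1) ≫ q = inj n ≫ q := by
    rw [Preadditive.sub_comp, Category.id_comp, sub_eq_zero] at hq
    rw [← reassoc_of% (inj_σ n), ← hq]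
  refine ⟨L, fun n => inj n ≫ q, hι, fun P hP h => ?_, fun X u hu => ?_, fun t ht f => ?_⟩
  · exact hP.ext₃ hL (hP.sigma_mem Y fun n => h n.down) (hP.sigma_mem Y fun n => h n.down)
  · let d : ∐ Y ⟶ X := Sigma.desc fun n : ULift.{v} ℕ => u n.down
    have h (n : ℕ) : inj n ≫ d = u n := Sigma.ι_desc _ _
    have hd : (𝟙 (∐ Y) - σ) ≫ d = 0 := hom_ext fun n => by
      rw [Preadditive.sub_comp, Preadditive.comp_sub, Category.id_comp, reassoc_of% (inj_σ n),
        h, h, hu, sub_self, comp_zero]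
    obtain ⟨w, hw⟩ : ∃ w : L ⟶ X, d = q ≫ w := Triangle.yoneda_exact₂ _ hL d hd
    exact ⟨w, fun n => by simp only [Category.assoc, ← hw, h]⟩
  -- The map `1 - shift` is injective on maps from `t` to the suspended coproduct, so that `f`
  -- lifts to the coproduct.
  have hδ : f ≫ δ = 0 := by
    have h₀ : f ≫ δ = (f ≫ δ) ≫ σ⟦(1 : ℤ)⟧' := by
      have : δ ≫ (𝟙 (∐ Y) - σ)⟦(1 : ℤ)⟧' = 0 := comp_distTriang_mor_zero₃₁ _ hL
      rw [Functor.map_sub, CategoryTheory.Functor.map_id, Preadditive.comp_sub, Category.comp_id,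
        sub_eq_zero] at this
      rw [Category.assoc, ← this]
    let c : Cofan Y := Cofan.mk (∐ Y) (Sigma.ι Y)
    have hc : IsColimit c := coproductIsCoproduct Y
    let π (n : ULift.{v} ℕ) : ∐ Y ⟶ Y n := sigmaProj Y hc n
    have σ_π_zero : σ ≫ π ⟨0⟩ = 0 := hom_ext fun n => by
      rw [reassoc_of% (inj_σ n), comp_zero]
      exact (congr(s n ≫ $(inj_sigmaProj_of_ne Y hc ⟨n + 1⟩ ⟨0⟩ (by simp)))).trans comp_zero
    have σ_π_succ (n : ℕ) : σ ≫ π ⟨n + 1⟩ = π ⟨n⟩ ≫ s n := hom_ext fun m => by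
      rw [reassoc_of% (inj_σ m)]
      by_cases h : m = n
      · subst h
        have h₁ : inj (m + 1) ≫ π ⟨m + 1⟩ = 𝟙 _ := inj_sigmaProj Y hc ⟨m + 1⟩
        have h₂ : inj m ≫ π ⟨m⟩ = 𝟙 _ := inj_sigmaProj Y hc ⟨m⟩
        rw [h₁, reassoc_of% h₂, Category.comp_id]
      · have h₁ : inj (m + 1) ≫ π ⟨n + 1⟩ = 0 :=
          inj_sigmaProj_of_ne Y hc ⟨m + 1⟩ ⟨n + 1⟩ (by simpa using h)
        have h₂ : inj m ≫ π ⟨n⟩ = 0 := inj_sigmaProj_of_ne Y hc ⟨m⟩ ⟨n⟩ (by simpa using h)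
        rw [h₁, reassoc_of% h₂, comp_zero, zero_comp]
    have hc' : IsColimit (Cofan.mk ((∐ Y)⟦(1 : ℤ)⟧) fun n => (c.inj n)⟦(1 : ℤ)⟧') :=
      Cofan.isColimitMapCoconeEquiv (shiftFunctor T (1 : ℤ)) Y c
        (isColimitOfPreserves (shiftFunctor T (1 : ℤ)) hc)
    refine ht.eq_zero_of_comp_eq_zero hc' (fun n => (π n)⟦(1 : ℤ)⟧') (fun n => ?_)
      (fun m n h => ?_) (f ≫ δ) fun n => ?_
    · exact (Functor.map_comp _ _ _).symm.trans
        ((congr((shiftFunctor T (1 : ℤ)).map $(inj_sigmaProj Y hc n))).trans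
          (CategoryTheory.Functor.map_id _ _))
    · exact (Functor.map_comp _ _ _).symm.trans
        ((congr((shiftFunctor T (1 : ℤ)).map $(inj_sigmaProj_of_ne Y hc m n h))).trans
          (Functor.map_zero _ _ _))
    · obtain ⟨n⟩ := n
      induction n with
      | zero => rw [h₀, Category.assoc, ← Functor.map_comp, σ_π_zero, Functor.map_zero, comp_zero]
      | succ n ih =>
        rw [h₀, Category.assoc, ← Functor.map_comp, σ_π_succ, Functor.map_comp, ← Category.assoc,
          ih, zero_comp]
  obtain ⟨g, hg⟩ : ∃ g : t ⟶ ∐ Y, f = g ≫ q := Triangle.coyoneda_exact₃ _ hL f hδ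
  clear hδ
  have push {n m : ℕ} (h : n ≤ m) (g : t ⟶ F n) :
      ∃ g' : t ⟶ F m, g' ≫ inj m ≫ q = g ≫ inj n ≫ q := by
    induction m, h using Nat.le_induction with
    | base => exact ⟨g, rfl⟩
    | succ m _ ih =>
      obtain ⟨g', hg'⟩ := ih
      exact ⟨g' ≫ s m, by rw [Category.assoc, hι, hg']⟩
  subst hg
  induction ht.mem_closure (coproductIsCoproduct Y) g using AddSubgroup.closure_induction with
  | mem g h =>
    obtain ⟨n, g, rfl⟩ := h
    exact ⟨n.down, g, (Category.assoc _ _ _).symm⟩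
  | zero => exact ⟨0, 0, by rw [zero_comp]; exact zero_comp.symm⟩
  | add f g _ _ hf hg =>
    obtain ⟨n, f', hf⟩ := hf
    obtain ⟨m, g', hg⟩ := hg
    obtain ⟨f'', hf'⟩ := push (le_max_left n m) f'
    obtain ⟨g'', hg'⟩ := push (le_max_right n m) g'
    refine ⟨max n m, f'' + g'', ?_⟩
    rw [Preadditive.add_comp, hf', hg', hf, hg]
    exact (Preadditive.add_comp _ _ _ _ _ _).symm
  | neg f _ hf =>
    obtain ⟨n, f', hf⟩ := hf
    refine ⟨n, -f', ?_⟩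
    rw [Preadditive.neg_comp, hf]
    exact (Preadditive.neg_comp _ _).symm

/-- Every object `X` receives a map `u` from an object `L` built from the compact objects `a i`
such that every map from some `a i` to `X` factors uniquely through `u`. The object `L` is the
homotopy colimit of a sequence, which starts with the coproduct of all `a i` over all maps
`a i ⟶ X`, and each step of which kills the maps `a i ⟶ Fₙ` that become zero in `X`. -/
lemma exists_cellular_approximation [HasCoproducts.{v} T] {P : ObjectProperty T}
    (hP : IsLocalising P) {I : Type v} (a : I → T) (ha : ∀ i, isCompact T (a i))
    (haP : ∀ i, P (a i)) (X : T) :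
    ∃ (L : T) (u : L ⟶ X), P L ∧ ∀ i, Function.Bijective fun f : a i ⟶ L => f ≫ u := by
  have step (F : { F : Over X // P F.left }) : ∃ (F' : { F : Over X // P F.left })
      (s : F.1 ⟶ F'.1), ∀ i (f : a i ⟶ F.1.left), f ≫ F.1.hom = 0 → f ≫ s.left = 0 := by
    let J := Σ i, { f : a i ⟶ F.1.left // f ≫ F.1.hom = 0 }
    let k : (∐ fun j : J => a j.1) ⟶ F.1.left := Sigma.desc fun j => j.2.1
    obtain ⟨F', s, δ, h⟩ := distinguished_cocone_triangle k
    have hk : k ≫ F.1.hom = 0 := Sigma.hom_ext _ _ fun j => by simp [k, j.2.2]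
    obtain ⟨w, hw⟩ : ∃ w : F' ⟶ X, F.1.hom = s ≫ w := Triangle.yoneda_exact₂ _ h F.1.hom hk
    refine ⟨⟨Over.mk w, hP.ext₃ h (hP.sigma_mem _ fun j => haP j.1) F.2⟩, Over.homMk s hw.symm,
      fun i f hf => ?_⟩
    have hf' : Sigma.ι (fun j : J => a j.1) ⟨i, f, hf⟩ ≫ k = f := Sigma.ι_desc _ _
    have hs : k ≫ s = 0 := comp_distTriang_mor_zero₁₂ _ h
    change f ≫ s = 0
    rw [← hf', Category.assoc, hs, comp_zero]
  choose next s hs using step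
  let J₀ := Σ i, (a i ⟶ X)
  let F₀ : { F : Over X // P F.left } :=
    ⟨Over.mk (Sigma.desc fun j : J₀ => j.2), hP.sigma_mem _ fun j => haP j.1⟩
  let F (n : ℕ) : { F : Over X // P F.left } := Nat.rec F₀ (fun _ => next) n
  obtain ⟨L, ι, hι, hL, desc, fac⟩ :=
    exists_homotopyColimit (fun n => (F n).1.left) (fun n => (s (F n)).left)
  obtain ⟨u, hu⟩ := desc X (fun n => (F n).1.hom) fun n => Over.w (s (F n))
  refine ⟨L, u, hL P hP fun n => (F n).2, fun i => ⟨?_, fun f => ?_⟩⟩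
  · refine (injective_iff_map_eq_zero (Preadditive.rightComp (a i) u)).2 fun f hf => ?_
    obtain ⟨n, g, rfl⟩ := fac _ (ha i) f
    have hg : g ≫ (F n).1.hom = 0 := by
      rw [← hu]
      exact (Category.assoc _ _ _).symm.trans hf
    rw [← hι, reassoc_of% (hs (F n) i g hg), zero_comp]
  · refine ⟨Sigma.ι (fun j : J₀ => a j.1) ⟨i, f⟩ ≫ ι 0, ?_⟩
    dsimp only
    rw [Category.assoc, hu]
    exact Sigma.ι_desc _ _

/-- Every object `X` sits in a triangle `L ⟶ X ⟶ C ⟶ L⟦1⟧` in which `L` is built from the compact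
objects `a i`, and `C` receives no nonzero map from a shift of some `a i`. -/
lemma exists_cellular_triangle [HasCoproducts.{v} T] {P : ObjectProperty T}
    (hP : IsLocalising P) {I : Type v} (a : I → T) (ha : ∀ i, isCompact T (a i))
    (haP : ∀ i, P (a i)) (X : T) :
    ∃ (L C : T) (u : L ⟶ X) (q : X ⟶ C) (δ : C ⟶ L⟦(1 : ℤ)⟧), Triangle.mk u q δ ∈ distTriang T ∧
      P L ∧ ∀ i (n : ℤ) (f : (a i)⟦n⟧ ⟶ C), f = 0 := by
  have := hP.isTriangulated
  let b : I × ULift.{v} ℤ → T := fun p => (a p.1)⟦p.2.down⟧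
  obtain ⟨L, u, hL, hu⟩ := exists_cellular_approximation hP b (fun p => (ha p.1).shift _)
    (fun p => P.le_shift _ _ (haP p.1)) X
  obtain ⟨C, q, δ, h⟩ := distinguished_cocone_triangle u
  refine ⟨L, C, u, q, δ, h, hL, fun i n f => ?_⟩
  have hδ : f ≫ δ = 0 := by
    -- Maps to `L⟦1⟧` are tested after shifting by `-1`.
    have hu₀ : (f ≫ δ) ≫ u⟦(1 : ℤ)⟧' = 0 := by
      have : δ ≫ u⟦(1 : ℤ)⟧' = 0 := comp_distTriang_mor_zero₃₁ _ h
      rw [Category.assoc, this, comp_zero]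
    let e : (a i)⟦n - 1⟧⟦(1 : ℤ)⟧ ≅ (a i)⟦n⟧ :=
      ((shiftFunctorAdd' T (n - 1) 1 n (by lia)).app _).symm
    obtain ⟨g, hg⟩ := (shiftFunctor T (1 : ℤ)).map_surjective (e.hom ≫ f ≫ δ)
    have hg₀ : g = 0 := (hu ⟨i, ⟨n - 1⟩⟩).1 <| (shiftFunctor T (1 : ℤ)).map_injective <| by
      dsimp only
      rw [Functor.map_comp, hg, zero_comp, Functor.map_zero, Category.assoc, hu₀, comp_zero]
    rw [hg₀, Functor.map_zero] at hg
    rw [← cancel_epi e.hom, ← hg, comp_zero]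
  obtain ⟨g, hg⟩ : ∃ g : (a i)⟦n⟧ ⟶ X, f = g ≫ q := Triangle.coyoneda_exact₃ _ h f hδ
  obtain ⟨g', rfl⟩ := (hu ⟨i, ⟨n⟩⟩).2 g
  have hq : u ≫ q = 0 := comp_distTriang_mor_zero₁₂ _ h
  simp only [hg, Category.assoc, hq, comp_zero]

end Cellular

/-! ### Orthogonals of sets of compact objects -/

section Shifts

variable {T : Type u} [Category.{v} T] [HasShift T ℤ]

/-- The objects isomorphic to a shift of a member of the family `a`. -/
def shiftsOf {I : Type*} (a : I → T) : ObjectProperty T :=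
  fun X => ∃ (i : I) (n : ℤ), Nonempty ((a i)⟦n⟧ ≅ X)

lemma shiftsOf_shift {I : Type*} (a : I → T) (i : I) (n : ℤ) : shiftsOf a ((a i)⟦n⟧) :=
  ⟨i, n, ⟨Iso.refl _⟩⟩

lemma shiftsOf_self {I : Type*} (a : I → T) (i : I) : shiftsOf a (a i) :=
  ⟨i, 0, ⟨(shiftFunctorZero T ℤ).app _⟩⟩

instance {I : Type*} (a : I → T) : (shiftsOf a).IsStableUnderShift ℤ where
  isStableUnderShiftBy m := ⟨fun _ ⟨i, n, ⟨e⟩⟩ =>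
    ⟨i, n + m, ⟨(shiftFunctorAdd T n m).app _ ≪≫ (shiftFunctor T m).mapIso e⟩⟩⟩

lemma rightOrthogonal_shiftsOf_iff {I : Type*} [Preadditive T] (a : I → T) (Y : T) :
    (shiftsOf a).rightOrthogonal Y ↔ ∀ i (n : ℤ) (f : (a i)⟦n⟧ ⟶ Y), f = 0 := by
  refine ⟨fun h i n f => h f (shiftsOf_shift a i n), fun h X f ⟨i, n, ⟨e⟩⟩ => ?_⟩
  rw [← cancel_epi e.hom, comp_zero, h i n (e.hom ≫ f)]

end Shifts

section Orthogonal

variable {T : Type u} [Category.{v} T] [HasZeroObject T] [HasShift T ℤ] [Preadditive T]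
  [∀ n : ℤ, (shiftFunctor T n).Additive] [Pretriangulated T]

lemma IsLocalising.inverseImage {P : ObjectProperty T} (hP : IsLocalising P) {F : T ⥤ T}
    (hF : IsExact F) (hF' : PreservesCoproducts F) : IsLocalising (P.inverseImage F) := by
  obtain ⟨_, _⟩ := hF
  have := hP.isTriangulated
  have := hP.isClosedUnderIsomorphisms
  exact ⟨inferInstance, inferInstance, fun J =>
    have := hP.coproducts J
    have := hF' J
    inferInstance⟩

lemma isLocalising_leftOrthogonal (P : ObjectProperty T) [P.IsStableUnderShift ℤ] :
    IsLocalising P.leftOrthogonal where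
  isTriangulated := inferInstance
  isClosedUnderIsomorphisms := inferInstance
  coproducts _ := ⟨fun _ ⟨h⟩ _ _ hY => h.isColimit.hom_ext fun j =>
    (h.prop_diag_obj j _ hY).trans comp_zero.symm⟩

lemma isColocalising_rightOrthogonal (P : ObjectProperty T) [P.IsStableUnderShift ℤ] :
    IsColocalising P.rightOrthogonal where
  isTriangulated := inferInstance
  isClosedUnderIsomorphisms := inferInstance
  products _ := ⟨fun _ ⟨h⟩ _ _ hX => h.isLimit.hom_ext fun j =>
    (h.prop_diag_obj j _ hX).trans zero_comp.symm⟩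

lemma shiftsOf_le {I : Type*} {a : I → T} {P : ObjectProperty T} (hP : IsLocalising P)
    (h : ∀ i, P (a i)) : shiftsOf a ≤ P := fun _ ⟨i, n, ⟨e⟩⟩ =>
  have := hP.isTriangulated
  hP.mem_of_iso e (P.le_shift n _ (h i))

/-- The right orthogonal of a family of compact objects and their shifts is localising. -/
lemma isLocalising_rightOrthogonal_shiftsOf {I : Type*} (a : I → T)
    (ha : ∀ i, isCompact T (a i)) : IsLocalising (shiftsOf a).rightOrthogonal where
  isTriangulated := inferInstance
  isClosedUnderIsomorphisms := inferInstance
  coproducts J := ⟨fun X ⟨h⟩ => by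
    rw [rightOrthogonal_shiftsOf_iff]
    intro i n f
    let c : Cofan (fun j => h.diag.obj ⟨j⟩) := Cofan.mk X fun j => h.ι.app ⟨j⟩
    have fac (s : Cofan fun j => h.diag.obj ⟨j⟩) (j : J) :
        h.ι.app ⟨j⟩ ≫ h.isColimit.desc ⟨s.pt, Discrete.natTrans fun j => s.inj j.as⟩ = s.inj j :=
      h.isColimit.fac _ _
    have hc : IsColimit c := Cofan.IsColimit.mk _ _ fac fun s m hm =>
      h.isColimit.hom_ext fun j => (hm j.as).trans (fac s j.as).symm
    exact ((ha i).shift n).eq_zero_of_isColimit hc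
      (fun j g => h.prop_diag_obj ⟨j⟩ g (shiftsOf_shift a i n)) f⟩

variable (T) in
/-- A set of compact generators, as a family indexed by a type in the universe of morphisms. -/
lemma exists_generating_family [HasCoproducts.{v} T] [IsCompactlyGenerated T] :
    ∃ (I : Type v) (a : I → T), (∀ i, isCompact T (a i)) ∧
      ∀ X, (shiftsOf a).rightOrthogonal X → IsZero X := by
  obtain ⟨G, _, hG, h⟩ := IsCompactlyGenerated.exists_generators (T := T)
  refine ⟨Shrink.{v} (Subtype G), fun i => ((equivShrink _).symm i).1,
    fun i => hG _ ((equivShrink _).symm i).2, fun X hX => (h X).2 fun g hg i f => ?_⟩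
  have hX' := ObjectProperty.le_shift _ i X hX
  refine hX' f ?_
  have := shiftsOf_self (fun i => ((equivShrink (Subtype G)).symm i).1) (equivShrink _ ⟨g, hg⟩)
  rwa [Equiv.symm_apply_apply] at this

/-- A localising subcategory containing a set of compact generators is everything. -/
lemma IsLocalising.eq_top [HasCoproducts.{v} T] {P : ObjectProperty T} (hP : IsLocalising P)
    {I : Type v} {a : I → T} (ha : ∀ i, isCompact T (a i))
    (hgen : ∀ X, (shiftsOf a).rightOrthogonal X → IsZero X) (h : ∀ i, P (a i)) (X : T) : P X := by
  have := hP.isTriangulated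
  have := hP.isClosedUnderIsomorphisms
  obtain ⟨L, C, u, q, δ, hT, hL, hC⟩ := exists_cellular_triangle hP a ha h X
  exact hP.ext₂ hT hL (P.prop_of_isZero (hgen C ((rightOrthogonal_shiftsOf_iff a C).2 hC)))

end Orthogonal

/-! ### Localising tensor-ideals generated by compact objects -/

section Tensor

variable {T : Type u} [Category.{v} T] [HasZeroObject T] [HasShift T ℤ] [Preadditive T]
  [∀ n : ℤ, (shiftFunctor T n).Additive] [Pretriangulated T]
  [HasCoproducts.{v} T] [MonoidalCategory T] [SymmetricCategory T]

/-- A localising subcategory which contains the tensor products of a set of compact generators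
with the elements of `S` contains the localising tensor-ideal generated by `S`. -/
lemma locTensor_le [IsCompactlyGeneratedTensor T] {S R : ObjectProperty T} (hR : IsLocalising R)
    {I : Type v} {a : I → T} (ha : ∀ i, isCompact T (a i))
    (hgen : ∀ X, (shiftsOf a).rightOrthogonal X → IsZero X)
    (h : ∀ i s, S s → R (a i ⊗ s)) : locTensor S ≤ R := by
  have hS (X s : T) (hs : S s) : R (X ⊗ s) :=
    (hR.inverseImage (IsCompactlyGeneratedTensor.exact_right s)
      (IsCompactlyGeneratedTensor.coproducts_right s)).eq_top ha hgen (fun i => h i s hs) X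
  -- The objects all of whose tensor multiples lie in `R` form a localising tensor-ideal.
  let Q : ObjectProperty T := fun Z => ∀ X, R (X ⊗ Z)
  have hX (X : T) : IsLocalising (R.inverseImage (tensorLeft X)) :=
    hR.inverseImage (IsCompactlyGeneratedTensor.exact_left X)
      (IsCompactlyGeneratedTensor.coproducts_left X)
  have hQ_iso : Q.IsClosedUnderIsomorphisms := ⟨fun e hZ X => (hX X).mem_of_iso e (hZ X)⟩
  have hQ : IsLocalising Q :=
    { isTriangulated :=
        { exists_zero := ⟨_, HasZeroObject.zero.choose_spec, fun X =>
            have := (hX X).isTriangulated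
            have := (hX X).isClosedUnderIsomorphisms
            (R.inverseImage (tensorLeft X)).prop_zero⟩
          isStableUnderShiftBy := fun n => ⟨fun Z hZ X =>
            have := (hX X).isTriangulated
            (R.inverseImage (tensorLeft X)).le_shift n Z (hZ X)⟩
          toIsTriangulatedClosed₂ := .mk' fun D hD h₁ h₃ X => (hX X).ext₂ hD (h₁ X) (h₃ X) }
      isClosedUnderIsomorphisms := hQ_iso
      coproducts := fun J => ⟨fun Z ⟨c⟩ X =>
        have := (hX X).coproducts J
        (R.inverseImage (tensorLeft X)).prop_of_isColimit c.isColimit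
          fun j => c.prop_diag_obj j X⟩ }
  intro Z hZ
  have : Q Z := hZ Q ⟨hQ, fun X Y hY X' => hR.mem_of_iso (α_ X' X Y) (hY _)⟩ fun s hs X => hS X s hs
  exact hR.mem_of_iso (λ_ Z) (this (𝟙_ T))

/-- The orthogonal of `loc^⊗(S)` is cut out by the shifts of the objects `a i ⊗ s`, for a set of
compact generators `a i` and `s` in `S`. -/
lemma rightOrthogonal_locTensor [IsCompactlyGeneratedTensor T] (S : ObjectProperty T)
    {I : Type v} {a : I → T} (ha : ∀ i, isCompact T (a i))
    (hgen : ∀ X, (shiftsOf a).rightOrthogonal X → IsZero X) :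
    (locTensor S).rightOrthogonal =
      (shiftsOf fun p : I × Subtype S => a p.1 ⊗ p.2.1).rightOrthogonal := by
  have hS := isLocalisingTensorIdeal_locTensor S
  have h₁ : shiftsOf (fun p : I × Subtype S => a p.1 ⊗ p.2.1) ≤ locTensor S :=
    shiftsOf_le hS.isLocalising fun p => hS.tensor_mem _ _ (le_locTensor S _ p.2.2)
  have h₂ : locTensor S ≤
      (shiftsOf fun p : I × Subtype S => a p.1 ⊗ p.2.1).rightOrthogonal.leftOrthogonal :=
    locTensor_le (isLocalising_leftOrthogonal _) ha hgen fun i s hs Y f hY =>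
      hY f (shiftsOf_self (fun p : I × Subtype S => a p.1 ⊗ p.2.1) ⟨i, s, hs⟩)
  ext Y
  exact ⟨fun hY X f hX => hY f (h₁ X hX), fun hY X f hX => h₂ X hX f hY⟩

/-- The unit is an extension of a `loc^⊗(S)`-local object by an object of `loc^⊗(S)`. -/
lemma exists_unit_triangle [IsCompactlyGeneratedTensor T] (S : ObjectProperty T)
    [ObjectProperty.Small.{v} S] (hS : S ≤ isCompact T) :
    ∃ (L C : T) (u : L ⟶ 𝟙_ T) (q : 𝟙_ T ⟶ C) (δ : C ⟶ L⟦(1 : ℤ)⟧),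
      Triangle.mk u q δ ∈ distTriang T ∧ locTensor S L ∧ (locTensor S).rightOrthogonal C := by
  obtain ⟨I, a, ha, hgen⟩ := exists_generating_family T
  have hS' := isLocalisingTensorIdeal_locTensor S
  let e := equivShrink.{v} (Subtype S)
  obtain ⟨L, C, u, q, δ, hT, hL, hC⟩ := exists_cellular_triangle hS'.isLocalising
    (fun p : I × Shrink.{v} (Subtype S) => a p.1 ⊗ (e.symm p.2).1)
    (fun p => ObjectProperty.prop_tensor (ha p.1) (hS _ (e.symm p.2).2))
    (fun p => hS'.tensor_mem _ _ (le_locTensor S _ (e.symm p.2).2)) (𝟙_ T)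
  refine ⟨L, C, u, q, δ, hT, hL, ?_⟩
  rw [rightOrthogonal_locTensor S ha hgen, rightOrthogonal_shiftsOf_iff]
  rintro ⟨i, s⟩ n f
  obtain ⟨j, rfl⟩ := e.symm.surjective s
  exact hC ⟨i, j⟩ n f

/-- In a rigid category, every object `k` is a retract of `k ⊗ (D ⊗ k)`, by means of a pairing
`k ⊗ D ⟶ 𝟙` and a copairing `𝟙 ⟶ D ⊗ k`. -/
lemma IsRigid.exists_pairing {K : Type u} [Category.{v} K] [MonoidalCategory K] (hK : IsRigid K)
    (k : K) : ∃ (D : K) (e : k ⊗ D ⟶ 𝟙_ K) (c : 𝟙_ K ⟶ D ⊗ k),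
      k ◁ c ≫ (α_ k D k).inv ≫ e ▷ k ≫ (λ_ k).hom = (ρ_ k).hom := by
  obtain ⟨_, h⟩ := hK
  have := h k k
  refine ⟨dual k, (ihom.ev k).app (𝟙_ K),
    MonoidalClosed.curry (ρ_ k).hom ≫ inv (evaluationMap k k), ?_⟩
  have h : (MonoidalClosed.curry (ρ_ k).hom ≫ inv (evaluationMap k k)) ≫ evaluationMap k k =
      MonoidalClosed.curry (ρ_ k).hom := by simp
  unfold evaluationMap at h
  rw [← MonoidalClosed.curry_natural_left] at h
  exact MonoidalClosed.curry_injective h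

/-- If `k` is a retract of `k ⊗ (D ⊗ k)` by means of a pairing and a copairing, then a map
`Z ⟶ Y ⊗ k` is determined by its adjunct `Z ⊗ D ⟶ Y`. -/
lemma eq_of_pairing {K : Type u} [Category.{v} K] [MonoidalCategory K] {k D : K}
    (e : k ⊗ D ⟶ 𝟙_ K) (c : 𝟙_ K ⟶ D ⊗ k)
    (h : k ◁ c ≫ (α_ k D k).inv ≫ e ▷ k ≫ (λ_ k).hom = (ρ_ k).hom) {Z Y : K} (f : Z ⟶ Y ⊗ k) :
    f = (ρ_ Z).inv ≫ Z ◁ c ≫ (α_ Z D k).inv ≫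
      (f ▷ D ≫ (α_ Y k D).hom ≫ Y ◁ e ≫ (ρ_ Y).hom) ▷ k := by
  symm
  calc
    _ = (ρ_ Z).inv ≫ (Z ◁ c ≫ f ▷ (D ⊗ k)) ≫ (α_ (Y ⊗ k) D k).inv ≫
          ((α_ Y k D).hom ≫ Y ◁ e ≫ (ρ_ Y).hom) ▷ k := by simp
    _ = ((ρ_ Z).inv ≫ f ▷ 𝟙_ K) ≫ (α_ Y k (𝟙_ K)).hom ≫
          Y ◁ (k ◁ c ≫ (α_ k D k).inv ≫ e ▷ k ≫ (λ_ k).hom) := by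
      rw [whisker_exchange]; monoidal
    _ = f := by rw [h, ← rightUnitor_inv_naturality]; simp

/-- The orthogonal of `loc^⊗(S)` is a localising tensor-ideal. It suffices to tensor with compact
objects, for which rigidity turns maps `Z ⟶ Y ⊗ g` into maps `Z ⊗ D ⟶ Y`. -/
lemma isLocalisingTensorIdeal_rightOrthogonal [IsRigidlyCompactlyGenerated T]
    {S : ObjectProperty T} (hS : S ≤ isCompact T) :
    IsLocalisingTensorIdeal (locTensor S).rightOrthogonal := by
  obtain ⟨I, a, ha, hgen⟩ := exists_generating_family T
  have hS' := isLocalisingTensorIdeal_locTensor S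
  have hC : IsLocalising (locTensor S).rightOrthogonal := by
    rw [rightOrthogonal_locTensor S ha hgen]
    exact isLocalising_rightOrthogonal_shiftsOf _ fun p =>
      ObjectProperty.prop_tensor (ha p.1) (hS _ p.2.2)
  refine ⟨hC, fun X Y hY => (hC.inverseImage (IsCompactlyGeneratedTensor.exact_right Y)
    (IsCompactlyGeneratedTensor.coproducts_right Y)).eq_top ha hgen (fun i => ?_) X⟩
  obtain ⟨D, e, c, h⟩ := (IsRigidlyCompactlyGenerated.rigid (T := T)).exists_pairing ⟨a i, ha i⟩
  have h : a i ◁ c.hom ≫ (α_ (a i) D.obj (a i)).inv ≫ e.hom ▷ a i ≫ (λ_ (a i)).hom =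
      (ρ_ (a i)).hom := congr(($h).hom)
  refine hC.mem_of_iso (β_ Y (a i)) fun Z f hZ => ?_
  have hZD : locTensor S (Z ⊗ D.obj) :=
    hS'.isLocalising.mem_of_iso (β_ D.obj Z) (hS'.tensor_mem _ _ hZ)
  rw [eq_of_pairing e.hom c.hom h f,
    hY (f ▷ D.obj ≫ (α_ Y (a i) D.obj).hom ≫ Y ◁ e.hom ≫ (ρ_ Y).hom) hZD]
  have : (tensorRight (a i)).PreservesZeroMorphisms := by
    obtain ⟨_, _⟩ := IsCompactlyGeneratedTensor.exact_right (a i)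
    infer_instance
  rw [show (0 : Z ⊗ D.obj ⟶ Y) ▷ a i = 0 from (tensorRight (a i)).map_zero _ _]
  simp

end Tensor

/-! ### Localisation sequences from a triangle on the unit -/

section UnitTriangle

variable {T : Type u} [Category.{v} T] [MonoidalCategory T]

/-- The map `L ⊗ X ⟶ X` induced by `u : L ⟶ 𝟙`, natural in `X`. -/
def tensorLeftCounit {L : T} (u : L ⟶ 𝟙_ T) : tensorLeft L ⟶ 𝟭 T where
  app X := u ▷ X ≫ (λ_ X).hom
  naturality X Y f := by
    dsimp
    rw [whisker_exchange_assoc, leftUnitor_naturality, Category.assoc]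

/-- The map `X ⟶ C ⊗ X` induced by `q : 𝟙 ⟶ C`, natural in `X`. -/
def tensorLeftUnit {C : T} (q : 𝟙_ T ⟶ C) : 𝟭 T ⟶ tensorLeft C where
  app X := (λ_ X).inv ≫ q ▷ X
  naturality X Y f := by
    dsimp
    rw [leftUnitor_inv_naturality_assoc, whisker_exchange, Category.assoc]

variable [HasZeroObject T] [HasShift T ℤ] [Preadditive T]
  [∀ n : ℤ, (shiftFunctor T n).Additive] [Pretriangulated T]

/-- Tensoring a triangle `L ⟶ 𝟙 ⟶ C` with `X` gives a triangle `L ⊗ X ⟶ X ⟶ C ⊗ X`. -/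
lemma exists_tensor_triangle {L C : T} {u : L ⟶ 𝟙_ T} {q : 𝟙_ T ⟶ C} {δ : C ⟶ L⟦(1 : ℤ)⟧}
    (hT : Triangle.mk u q δ ∈ distTriang T) {X : T} (hX : IsExact (tensorRight X)) :
    ∃ δ' : C ⊗ X ⟶ (L ⊗ X)⟦(1 : ℤ)⟧, Triangle.mk ((tensorLeftCounit u).app X)
      ((tensorLeftUnit q).app X) δ' ∈ distTriang T := by
  obtain ⟨_, _⟩ := hX
  have h : Triangle.mk (u ▷ X) (q ▷ X)
      (δ ▷ X ≫ ((tensorRight X).commShiftIso (1 : ℤ)).hom.app L) ∈ distTriang T :=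
    (tensorRight X).map_distinguished _ hT
  refine ⟨δ ▷ X ≫ ((tensorRight X).commShiftIso (1 : ℤ)).hom.app L,
    isomorphic_distinguished _ h _ (Triangle.isoMk (Triangle.mk _ _ _) (Triangle.mk _ _ _)
      (Iso.refl (L ⊗ X)) (λ_ X).symm (Iso.refl (C ⊗ X)) ?_ ?_ ?_)⟩
  · exact (by simp : (u ▷ X ≫ (λ_ X).hom) ≫ (λ_ X).inv = 𝟙 (L ⊗ X) ≫ u ▷ X)
  · exact Category.comp_id _
  · exact (congr(_ ≫ $((shiftFunctor T (1 : ℤ)).map_id _))).trans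
      ((Category.comp_id _).trans (Category.id_comp _).symm)

end UnitTriangle

section Adjunctions

variable {T : Type u} [Category.{v} T]

/-- A functor `F` with values in `P`, together with a natural map `F X ⟶ X` inducing bijections on
maps from the objects of `P`, is right adjoint to the inclusion of `P`. -/
noncomputable def coreflectionAdj (P : ObjectProperty T) (F : T ⥤ T) (hF : ∀ X, P (F.obj X))
    (τ : F ⟶ 𝟭 T) (hτ : ∀ Z X, P Z → Function.Bijective fun f : Z ⟶ F.obj X => f ≫ τ.app X) :
    P.ι ⊣ P.lift F hF :=
  let e (Z : P.FullSubcategory) (X : T) : (Z ⟶ (P.lift F hF).obj X) ≃ (P.ι.obj Z ⟶ X) :=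
    P.fullyFaithfulι.homEquiv.trans (Equiv.ofBijective _ (hτ Z.1 X Z.2))
  Adjunction.mkOfHomEquiv
    { homEquiv := fun Z X => (e Z X).symm
      homEquiv_naturality_left_symm := fun _ _ => Category.assoc _ _ _
      homEquiv_naturality_right := fun {Z X X'} f g => by
        obtain ⟨f, rfl⟩ := (e Z X).surjective f
        rw [Equiv.symm_apply_eq, Equiv.symm_apply_apply]
        change (f.hom ≫ τ.app X) ≫ g = (f.hom ≫ F.map g) ≫ τ.app X'
        simp }

/-- A functor `F` with values in `P`, together with a natural map `X ⟶ F X` inducing bijections on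
maps to the objects of `P`, is left adjoint to the inclusion of `P`. -/
noncomputable def reflectionAdj (P : ObjectProperty T) (F : T ⥤ T) (hF : ∀ X, P (F.obj X))
    (τ : 𝟭 T ⟶ F) (hτ : ∀ X Z, P Z → Function.Bijective fun f : F.obj X ⟶ Z => τ.app X ≫ f) :
    P.lift F hF ⊣ P.ι :=
  let e (X : T) (Z : P.FullSubcategory) : ((P.lift F hF).obj X ⟶ Z) ≃ (X ⟶ P.ι.obj Z) :=
    P.fullyFaithfulι.homEquiv.trans (Equiv.ofBijective _ (hτ X Z.1 Z.2))
  Adjunction.mkOfHomEquiv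
    { homEquiv := e
      homEquiv_naturality_left_symm := fun {X X' Z} f g => by
        obtain ⟨g, rfl⟩ := (e X' Z).surjective g
        rw [Equiv.symm_apply_eq, Equiv.symm_apply_apply]
        change f ≫ τ.app X' ≫ g.hom = τ.app X ≫ F.map f ≫ g.hom
        have := τ.naturality_assoc f g.hom
        exact this
      homEquiv_naturality_right := fun _ _ => (Category.assoc _ _ _).symm }

end Adjunctions

namespace LocalisationSequence

variable {T : Type u} [Category.{v} T] [HasZeroObject T] [HasShift T ℤ] [Preadditive T]
  [∀ n : ℤ, (shiftFunctor T n).Additive] [Pretriangulated T]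
  {P C : ObjectProperty T} (E : LocalisationSequence P C)

/-- The acyclisation functor is determined up to isomorphism by its adjunction. -/
lemma nonempty_iso_acyclisation {F : T ⥤ T} {hF : ∀ X, P (F.obj X)} (adj : P.ι ⊣ P.lift F hF) :
    Nonempty (F ≅ E.acyclisation) :=
  ⟨Functor.isoWhiskerRight (adj.rightAdjointUniq E.iAdj) P.ι⟩

/-- The localisation functor is determined up to isomorphism by its adjunction. -/
lemma nonempty_iso_localisation {F : T ⥤ T} {hF : ∀ X, C (F.obj X)} (adj : C.lift F hF ⊣ C.ι) :
    Nonempty (F ≅ E.localisation) :=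
  ⟨Functor.isoWhiskerRight (adj.leftAdjointUniq E.jAdj) C.ι⟩

/-- The inclusion `i_*` is fully faithful, hence reflects coproducts, so that `i^!` preserves them
as soon as `i_* i^!` does. -/
lemma isSmashing_of_preservesCoproducts (h : PreservesCoproducts E.acyclisation) :
    E.IsSmashing := fun J =>
  have := h J
  preservesColimitsOfShape_of_reflects_of_preserves E.iShriek P.ι

lemma acyclisation_mem (X : T) : P (E.acyclisation.obj X) := (E.iShriek.obj X).2

lemma localisation_mem (X : T) : C (E.localisation.obj X) := (E.jStar.obj X).2

lemma nonempty_acyclisation_obj_iso {X : T} (hX : P X) : Nonempty (E.acyclisation.obj X ≅ X) :=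
  ⟨(P.ι.mapIso (asIso (E.iAdj.unit.app ⟨X, hX⟩))).symm⟩

lemma nonempty_localisation_obj_iso {X : T} (hX : C X) : Nonempty (E.localisation.obj X ≅ X) :=
  ⟨C.ι.mapIso (asIso (E.jAdj.counit.app ⟨X, hX⟩))⟩

end LocalisationSequence

section Sequence

variable {T : Type u} [Category.{v} T] [HasZeroObject T] [HasShift T ℤ] [Preadditive T]
  [∀ n : ℤ, (shiftFunctor T n).Additive] [Pretriangulated T] [MonoidalCategory T]
  {P : ObjectProperty T} {L C : T} {u : L ⟶ 𝟙_ T} {q : 𝟙_ T ⟶ C} {δ : C ⟶ L⟦(1 : ℤ)⟧}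

/-- If `L ⟶ 𝟙 ⟶ C` is a triangle with `L ⊗ X ∈ P` and `C ⊗ X ∈ P^⊥` for all `X`, then `L ⊗ -`
is right adjoint to the inclusion of `P`. -/
noncomputable def tensorLeftCoreflection (hP : IsLocalising P)
    (hT : Triangle.mk u q δ ∈ distTriang T) (hex : ∀ X : T, IsExact (tensorRight X))
    (hL : ∀ X, P (L ⊗ X)) (hC : ∀ X, P.rightOrthogonal (C ⊗ X)) :
    P.ι ⊣ P.lift (tensorLeft L) hL :=
  coreflectionAdj P (tensorLeft L) hL (tensorLeftCounit u) fun Z X hZ => by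
    have := hP.isTriangulated
    obtain ⟨δ', h⟩ := exists_tensor_triangle hT (hex X)
    have hZ' : P.rightOrthogonal.leftOrthogonal Z := fun _ f hY => hY f hZ
    rw [← ObjectProperty.isColocal_trW] at hZ'
    exact hZ' _ (ObjectProperty.trW.mk _ h (hC X))

/-- If `L ⟶ 𝟙 ⟶ C` is a triangle with `L ⊗ X ∈ P` and `C ⊗ X ∈ P^⊥` for all `X`, then `C ⊗ -`
is left adjoint to the inclusion of `P^⊥`. -/
noncomputable def tensorLeftReflection (hP : IsLocalising P)
    (hT : Triangle.mk u q δ ∈ distTriang T) (hex : ∀ X : T, IsExact (tensorRight X))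
    (hL : ∀ X, P (L ⊗ X)) (hC : ∀ X, P.rightOrthogonal (C ⊗ X)) :
    P.rightOrthogonal.lift (tensorLeft C) hC ⊣ P.rightOrthogonal.ι :=
  reflectionAdj P.rightOrthogonal (tensorLeft C) hC (tensorLeftUnit q) fun X Z hZ => by
    have := hP.isTriangulated
    obtain ⟨δ', h⟩ := exists_tensor_triangle hT (hex X)
    rw [← ObjectProperty.isLocal_trW] at hZ
    exact hZ _ (ObjectProperty.trW.mk' _ h (hL X))

/-- A triangle `L ⟶ 𝟙 ⟶ C` with `L ⊗ X ∈ P` and `C ⊗ X ∈ P^⊥` for all `X` gives rise to a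
localisation sequence whose functors are `L ⊗ -` and `C ⊗ -`. -/
noncomputable def localisationSequenceOfUnitTriangle (hP : IsLocalising P)
    (hT : Triangle.mk u q δ ∈ distTriang T) (hex : ∀ X : T, IsExact (tensorRight X))
    (hL : ∀ X, P (L ⊗ X)) (hC : ∀ X, P.rightOrthogonal (C ⊗ X)) :
    LocalisationSequence P P.rightOrthogonal where
  iShriek := P.lift (tensorLeft L) hL
  iAdj := tensorLeftCoreflection hP hT hex hL hC
  jStar := P.rightOrthogonal.lift (tensorLeft C) hC
  jAdj := tensorLeftReflection hP hT hex hL hC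
  isLocalising := hP
  isColocalising :=
    have := hP.isTriangulated
    isColocalising_rightOrthogonal P
  rightOrthogonal_eq := rfl
  leftOrthogonal_eq := by
    have := hP.isTriangulated
    have := hP.isClosedUnderIsomorphisms
    have le : P ≤ P.rightOrthogonal.leftOrthogonal := fun _ hX _ f hY => hY f hX
    refine le_antisymm (fun X hX => ?_) le
    obtain ⟨δ', h⟩ := exists_tensor_triangle hT (hex X)
    -- `C ⊗ X` lies both in `P^⊥` and in `⊥(P^⊥)`, hence it vanishes.
    have hCX : P.rightOrthogonal.leftOrthogonal (C ⊗ X) :=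
      ObjectProperty.ext_of_isTriangulatedClosed₃ _ _ h (le _ (hL X)) hX
    exact hP.ext₂ h (hL X) (P.prop_of_isZero ((IsZero.iff_id_eq_zero _).2 (hCX (𝟙 _) (hC X))))

end Sequence

end TensorTriangular

theorem mainTheorem3 {T : Type u} [Category.{v} T] [HasZeroObject T] [HasShift T ℤ]
    [Preadditive T] [∀ n : ℤ, (shiftFunctor T n).Additive] [Pretriangulated T] [IsTriangulated T]
    [HasCoproducts.{v} T] [MonoidalCategory T] [SymmetricCategory T]
    [IsRigidlyCompactlyGenerated T]
    (S : ObjectProperty T) [ObjectProperty.Small.{v} S] (hS : S ≤ isCompact T) :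
    Nonempty (LocalisationSequence (locTensor S) (locTensor S).rightOrthogonal) ∧
    IsLocalisingTensorIdeal (locTensor S).rightOrthogonal ∧
    ∀ E : LocalisationSequence (locTensor S) (locTensor S).rightOrthogonal,
      E.IsSmashing ∧
      Nonempty (tensorLeft (E.acyclisation.obj (𝟙_ T)) ≅ E.acyclisation) ∧
      Nonempty (tensorLeft (E.localisation.obj (𝟙_ T)) ≅ E.localisation) ∧
      Nonempty (E.acyclisation.obj (𝟙_ T) ⊗ E.acyclisation.obj (𝟙_ T) ≅
        E.acyclisation.obj (𝟙_ T)) ∧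
      Nonempty (E.localisation.obj (𝟙_ T) ⊗ E.localisation.obj (𝟙_ T) ≅
        E.localisation.obj (𝟙_ T)) ∧
      IsZero (E.acyclisation.obj (𝟙_ T) ⊗ E.localisation.obj (𝟙_ T)) := by
  have hP := isLocalisingTensorIdeal_locTensor S
  have hQ := isLocalisingTensorIdeal_rightOrthogonal hS
  have hex (X : T) : IsExact (tensorRight X) := IsCompactlyGeneratedTensor.exact_right X
  obtain ⟨L, C, u, q, δ, hT, hL, hC⟩ := exists_unit_triangle S hS
  have hL' (X : T) : locTensor S (L ⊗ X) :=
    hP.isLocalising.mem_of_iso (β_ X L) (hP.tensor_mem X L hL)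
  have hC' (X : T) : (locTensor S).rightOrthogonal (C ⊗ X) :=
    hQ.isLocalising.mem_of_iso (β_ X C) (hQ.tensor_mem X C hC)
  refine ⟨⟨localisationSequenceOfUnitTriangle hP.isLocalising hT hex hL' hC'⟩, hQ, fun E => ?_⟩
  obtain ⟨eL⟩ := E.nonempty_iso_acyclisation
    (tensorLeftCoreflection hP.isLocalising hT hex hL' hC')
  obtain ⟨eC⟩ := E.nonempty_iso_localisation
    (tensorLeftReflection hP.isLocalising hT hex hL' hC')
  -- Evaluating at the unit identifies `L` with `i_* i^! 𝟙` and `C` with `j_* j^* 𝟙`.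
  let eL' : tensorLeft (E.acyclisation.obj (𝟙_ T)) ≅ E.acyclisation :=
    (tensoringLeft T).mapIso (eL.symm.app (𝟙_ T) ≪≫ ρ_ L) ≪≫ eL
  let eC' : tensorLeft (E.localisation.obj (𝟙_ T)) ≅ E.localisation :=
    (tensoringLeft T).mapIso (eC.symm.app (𝟙_ T) ≪≫ ρ_ C) ≪≫ eC
  have hL₁ := E.acyclisation_mem (𝟙_ T)
  have hC₁ := E.localisation_mem (𝟙_ T)
  obtain ⟨iL⟩ := E.nonempty_acyclisation_obj_iso hL₁
  obtain ⟨iC⟩ := E.nonempty_localisation_obj_iso hC₁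
  refine ⟨E.isSmashing_of_preservesCoproducts fun J => ?_, ⟨eL'⟩, ⟨eC'⟩, ⟨eL'.app _ ≪≫ iL⟩,
    ⟨eC'.app _ ≪≫ iC⟩, ?_⟩
  · have := IsCompactlyGeneratedTensor.coproducts_left L J
    exact preservesColimitsOfShape_of_natIso eL
  · -- This object lies in both `loc^⊗(S)` and its orthogonal.
    exact (IsZero.iff_id_eq_zero _).2 (hQ.tensor_mem _ _ hC₁ (𝟙 _)
      (hP.isLocalising.mem_of_iso (β_ _ _) (hP.tensor_mem _ _ hL₁)))
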